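/- Let $\mathbb D^2$ be the open unit bidisc in $\mathbb C^2$ and $\mathbb T^2$ the torus. Let $\mathcal S(\mathbb D^2)$ be the set of analytic functions on $\mathbb D^2$ that are bounded by $1$ in modulus. A function $f\in\mathcal S(\mathbb D^2)$ is rational inner if it is rational and $|f|=1$ almost everywhere on $\mathbb T^2$. An algebraic set $V\subset\mathbb C^2$ (not necessarily irreducible) is called an inner variety if $V\cap\mathbb D^2\neq\emptyset$ and $V\cap\partial(\mathbb D^2)\subset\mathbb T^2$. For functions $F=\sum a_{n}z^{n}$ and $G=\sum b_{n}z^{n}$ analytic on $\mathbb D^2$ with square-summable Taylor coefficients at the origin ($n\in\mathbb N^2$), put $\langle F,G\rangle=\sum_n a_n\overline{b_n}$ and $\|F\|_2^2=\sum_n|a_n|^2$. Theorem. Let $f$ be a rational inner function on $\mathbb D^2$ and let $p\in\mathbb C[z_1,z_2]$ be a polynomial without repeated factors (for example an irreducible one) whose zero set $V=Z_p$ is an inner variety. Suppose that for each function $g$, analytic and not identically zero on $\mathbb D^2$, such that $pg$ is bounded on $\mathbb D^2$, the inequality \[2\operatorname{Re}\langle f,pg\rangle<\|pg\|_2^2\]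 holds. Then $V$ is a strong Pick set for $f$: every $h\in\mathcal S(\mathbb D^2)$ that equals $f$ on $V\cap\mathbb D^2$ equals $f$ on $\mathbb D^2$. -/

import Mathlib

namespace StrongPick

/-- The open unit bidisc `𝔻²`. -/
def bidisc : Set (Fin 2 → ℂ) := {z | ∀ i, ‖z i‖ < 1}

/-- The torus `𝕋²`. -/
def torus : Set (Fin 2 → ℂ) := {z | ∀ i, ‖z i‖ = 1}

/-- The Schur class of the bidisc. A function on `𝔻²` is represented by a total function on `ℂ²`;
its values outside `𝔻²` play no role. -/
structure IsSchur (f : (Fin 2 → ℂ) → ℂ) : Prop where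
  analytic : AnalyticOnNhd ℂ f bidisc
  norm_le_one : ∀ z ∈ bidisc, ‖f z‖ ≤ 1

/-- A rational inner function on the bidisc: a Schur function `f = q / r` with polynomials `q`, `r`
such that `|q / r| = 1` almost everywhere on the torus. The denominator is taken without zeros in
`𝔻²`, as it has in the lowest-terms representation of any rational function analytic on `𝔻²`.
"Almost everywhere on `𝕋²`" is expressed in the angles `θ`, through `θ ↦ (exp (i θ₀), exp (i θ₁))`;
it says in particular that `r` vanishes only on a null set of the torus. -/
structure IsRationalInner (f : (Fin 2 → ℂ) → ℂ) : Prop where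
  schur : IsSchur f
  rational_inner : ∃ q r : MvPolynomial (Fin 2) ℂ,
    (∀ z ∈ bidisc, MvPolynomial.eval z r ≠ 0 ∧
      f z = MvPolynomial.eval z q / MvPolynomial.eval z r) ∧
    ∀ᵐ θ : Fin 2 → ℝ, ‖MvPolynomial.eval (torusMap 0 1 θ) q /
      MvPolynomial.eval (torusMap 0 1 θ) r‖ = 1

/-- The zero set `Z_p` of a polynomial in `ℂ²`. -/
def zeroSet (p : MvPolynomial (Fin 2) ℂ) : Set (Fin 2 → ℂ) := {z | MvPolynomial.eval z p = 0}

/-- An algebraic subset of `ℂ²` that meets the bidisc and exits it through the torus.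
Irreducibility is not required. -/
structure IsInnerVariety (V : Set (Fin 2 → ℂ)) : Prop where
  algebraic : ∃ S : Set (MvPolynomial (Fin 2) ℂ), V = {z | ∀ q ∈ S, MvPolynomial.eval z q = 0}
  meets : (V ∩ bidisc).Nonempty
  exits : V ∩ frontier bidisc ⊆ torus

/-- `V` is a strong Pick set for `f`: each Schur function that equals `f` on `V ∩ 𝔻²` equals `f`
on `𝔻²`. -/
def IsStrongPickSet (V : Set (Fin 2 → ℂ)) (f : (Fin 2 → ℂ) → ℂ) : Prop :=
  ∀ h : (Fin 2 → ℂ) → ℂ, IsSchur h → (∀ z ∈ V ∩ bidisc, h z = f z) → ∀ z ∈ bidisc, h z = f z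

/-- The Taylor coefficient at the origin of `z₀ ^ n.1 * z₁ ^ n.2`, that is
`(∂₀ ^ n.1 ∂₁ ^ n.2 F) (0, 0) / (n.1! n.2!)`. -/
noncomputable def taylorCoeff (F : (Fin 2 → ℂ) → ℂ) (n : ℕ × ℕ) : ℂ :=
  iteratedDeriv n.1 (fun z : ℂ => iteratedDeriv n.2 (fun w : ℂ => F ![z, w]) 0) 0 /
    ((n.1.factorial : ℂ) * (n.2.factorial : ℂ))

/-- The inner product `⟨F, G⟩ = ∑ aₙ conj bₙ` of the Hardy space `H²` of the bidisc (linear in the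
first variable). The series converges absolutely for `F`, `G` in `H²`, in particular for bounded
analytic functions. -/
noncomputable def hardyInner (F G : (Fin 2 → ℂ) → ℂ) : ℂ :=
  ∑' n : ℕ × ℕ, taylorCoeff F n * (starRingEnd ℂ) (taylorCoeff G n)

/-- The norm `‖F‖₂ = (∑ |aₙ|²)^(1/2)` of the Hardy space `H²` of the bidisc. -/
noncomputable def hardyNorm (F : (Fin 2 → ℂ) → ℂ) : ℝ :=
  Real.sqrt (∑' n : ℕ × ℕ, ‖taylorCoeff F n‖ ^ 2)

end StrongPick

open StrongPick

/-! Let `h` be a Schur function that agrees with `f` on `Z_p ∩ 𝔻²`. Two facts give `h = f`.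

*Division.* The function `f - h` vanishes on `Z_p ∩ 𝔻²`, hence `f - h = p g` with `g` analytic on `𝔻²`
(`exists_quotient`). This uses that `p` is squarefree and that `Z_p` leaves `𝔻²` through the torus.
The latter says that `p` has no zeros with `‖z₀‖ = 1` and `‖z₁‖ < 1`, so the Cauchy integral of
`(f - h) / p` in the variable `z₀`, over a circle of radius slightly less than `1`, is an analytic
function near any given point. By Gauss's lemma, a Bézout identity between `p` and `∂p/∂z₀` shows
that the slices `p (·, z₁)` have only simple roots unless `z₁` is a zero of a certain nonzero
polynomial. For such `z₁` the quotient `(f - h) / p` has removable singularities and equals its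
Cauchy integral; the other `z₁` are reached by continuity.

*Hardy norms.* Parseval's identity on the tori of radius `r < 1` shows that every Schur function has
Hardy norm at most `1` (`sum_norm_sq_taylorCoeff_le`); letting `r` tend to `1`, it also shows that a
rational inner function has norm at least `1` (`one_le_tsum_norm_sq_taylorCoeff`).

If `f - h = p g` were not zero, the hypothesis `2 Re ⟨f, p g⟩ < ‖p g‖²` would say
`‖f‖² < ‖f - p g‖² = ‖h‖²`, whereas `‖h‖ ≤ 1 ≤ ‖f‖`. -/

namespace StrongPick

open Filter Topology MeasureTheory

/-! ### Taylor coefficients of bounded analytic functions on the bidisc -/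

lemma isOpen_bidisc : IsOpen bidisc := by
  have : bidisc = ⋂ i : Fin 2, {z : Fin 2 → ℂ | ‖z i‖ < 1} := by
    ext z; simp [bidisc]
  rw [this]
  exact isOpen_iInter_of_finite fun i =>
    isOpen_lt ((continuous_apply i).norm) continuous_const

lemma vec_mem_bidisc {z w : ℂ} (hz : ‖z‖ < 1) (hw : ‖w‖ < 1) : ![z, w] ∈ bidisc := by
  intro i
  fin_cases i
  · exact hz
  · exact hw

lemma hasDerivAt_vec_snd (z w : ℂ) : HasDerivAt (fun w : ℂ => ![z, w]) ![0, 1] w := by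
  rw [hasDerivAt_pi]
  intro i
  fin_cases i
  · exact hasDerivAt_const w z
  · exact hasDerivAt_id w

lemma hasDerivAt_vec_fst (z w : ℂ) : HasDerivAt (fun z : ℂ => ![z, w]) ![1, 0] z := by
  rw [hasDerivAt_pi]
  intro i
  fin_cases i
  · exact hasDerivAt_id z
  · exact hasDerivAt_const z w

lemma analyticOnNhd_partial_snd {F : (Fin 2 → ℂ) → ℂ} (hF : AnalyticOnNhd ℂ F bidisc) :
    AnalyticOnNhd ℂ (fun z => deriv (fun w => F ![z 0, w]) (z 1)) bidisc := by
  have h1 : AnalyticOnNhd ℂ (fun z => fderiv ℂ F z ![0, 1]) bidisc := fun z hz =>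
    ((ContinuousLinearMap.apply ℂ ℂ (![0, 1] : Fin 2 → ℂ)).analyticAt _).comp (hF.fderiv z hz)
  refine h1.congr isOpen_bidisc fun z hz => ?_
  have hz' : ![z 0, z 1] = z := by ext i; fin_cases i <;> rfl
  have h2 : HasFDerivAt F (fderiv ℂ F z) ![z 0, z 1] := by
    rw [hz']; exact (hF z hz).differentiableAt.hasFDerivAt
  exact (h2.comp_hasDerivAt (z 1) (hasDerivAt_vec_snd (z 0) (z 1))).deriv.symm

/-- Partial derivatives in the second variable, of any order, are analytic in both variables. -/
lemma analyticOnNhd_iteratedDeriv_snd {F : (Fin 2 → ℂ) → ℂ} (hF : AnalyticOnNhd ℂ F bidisc)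
    (n : ℕ) :
    AnalyticOnNhd ℂ (fun z => iteratedDeriv n (fun w => F ![z 0, w]) (z 1)) bidisc := by
  induction n with
  | zero =>
    simp only [iteratedDeriv_zero]
    refine hF.congr isOpen_bidisc fun z _ => ?_
    congr 1
    ext i; fin_cases i <;> rfl
  | succ n ih =>
    simp only [iteratedDeriv_succ]
    exact analyticOnNhd_partial_snd ih

lemma differentiableOn_slice_fst {F : (Fin 2 → ℂ) → ℂ} (hF : AnalyticOnNhd ℂ F bidisc)
    {w : ℂ} (hw : ‖w‖ < 1) : DifferentiableOn ℂ (fun z => F ![z, w]) (Metric.ball 0 1) := by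
  intro z hz
  have hz' : ‖z‖ < 1 := by simpa using hz
  exact ((hF _ (vec_mem_bidisc hz' hw)).differentiableAt.hasFDerivAt.comp_hasDerivAt z
    (hasDerivAt_vec_fst z w)).differentiableAt.differentiableWithinAt

lemma differentiableOn_slice_snd {F : (Fin 2 → ℂ) → ℂ} (hF : AnalyticOnNhd ℂ F bidisc)
    {z : ℂ} (hz : ‖z‖ < 1) : DifferentiableOn ℂ (fun w => F ![z, w]) (Metric.ball 0 1) := by
  intro w hw
  have hw' : ‖w‖ < 1 := by simpa using hw
  exact ((hF _ (vec_mem_bidisc hz hw')).differentiableAt.hasFDerivAt.comp_hasDerivAt w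
    (hasDerivAt_vec_snd z w)).differentiableAt.differentiableWithinAt

/-- Cauchy's estimate on the open unit disc, without assumptions on the boundary. -/
lemma norm_iteratedDeriv_div_factorial_le {u : ℂ → ℂ} (hu : DifferentiableOn ℂ u (Metric.ball 0 1))
    {C : ℝ} (hC : ∀ z, ‖z‖ < 1 → ‖u z‖ ≤ C) (n : ℕ) :
    ‖iteratedDeriv n u 0 / (n.factorial : ℂ)‖ ≤ C := by
  have hlim : Tendsto (fun R : ℝ => C / R ^ n) (𝓝[<] 1) (𝓝 C) := by
    have : ContinuousAt (fun R : ℝ => C / R ^ n) 1 := by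
      refine ContinuousAt.div continuousAt_const (by fun_prop) (by simp)
    have := this.tendsto.mono_left (nhdsWithin_le_nhds (s := Set.Iio 1))
    simpa using this
  refine ge_of_tendsto hlim ?_
  filter_upwards [Ioo_mem_nhdsLT (show (0 : ℝ) < 1 by norm_num)] with R hR
  have h := Complex.norm_iteratedDeriv_le_of_forall_mem_sphere_norm_le (c := 0) (C := C) n hR.1
    (f := u) (DifferentiableOn.diffContOnCl (hu.mono ?_)) ?_
  · rw [norm_div, Complex.norm_natCast, div_le_iff₀ (by positivity)]
    calc _ ≤ _ := h
      _ = _ := by ring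
  · refine Metric.closure_ball_subset_closedBall.trans ?_
    exact Metric.closedBall_subset_ball hR.2
  · intro z hz
    exact hC z (by rw [mem_sphere_zero_iff_norm.1 hz]; exact hR.2)

lemma differentiableOn_iteratedDeriv_snd {F : (Fin 2 → ℂ) → ℂ} (hF : AnalyticOnNhd ℂ F bidisc)
    (n : ℕ) :
    DifferentiableOn ℂ (fun z => iteratedDeriv n (fun w => F ![z, w]) 0 / (n.factorial : ℂ))
      (Metric.ball 0 1) :=
  (differentiableOn_slice_fst (analyticOnNhd_iteratedDeriv_snd hF n)
    (w := 0) (by simp)).div_const _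

/-- `taylorCoeff F (m, n)` is the `m`-th Taylor coefficient of the `n`-th Taylor coefficient of the
slices `F (z, ·)`. -/
lemma taylorCoeff_eq (F : (Fin 2 → ℂ) → ℂ) (n : ℕ × ℕ) :
    taylorCoeff F n = iteratedDeriv n.1
      (fun z => iteratedDeriv n.2 (fun w => F ![z, w]) 0 / (n.2.factorial : ℂ)) 0 /
        (n.1.factorial : ℂ) := by
  have : (fun z => iteratedDeriv n.2 (fun w => F ![z, w]) 0 / (n.2.factorial : ℂ)) =
      fun z => ((n.2.factorial : ℂ))⁻¹ * iteratedDeriv n.2 (fun w => F ![z, w]) 0 := by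
    ext z; rw [div_eq_inv_mul]
  rw [this, iteratedDeriv_const_mul_field, taylorCoeff]
  field_simp

lemma norm_taylorCoeff_le {F : (Fin 2 → ℂ) → ℂ} (hF : AnalyticOnNhd ℂ F bidisc) {C : ℝ}
    (hC : ∀ z ∈ bidisc, ‖F z‖ ≤ C) (n : ℕ × ℕ) : ‖taylorCoeff F n‖ ≤ C := by
  rw [taylorCoeff_eq]
  refine norm_iteratedDeriv_div_factorial_le (differentiableOn_iteratedDeriv_snd hF n.2) ?_ _
  intro z hz
  exact norm_iteratedDeriv_div_factorial_le (differentiableOn_slice_snd hF hz)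
    (fun w hw => hC _ (vec_mem_bidisc hz hw)) _

lemma summable_pow_mul_pow {x y : ℝ} (hx : 0 ≤ x) (hx1 : x < 1) (hy : 0 ≤ y) (hy1 : y < 1) :
    Summable fun n : ℕ × ℕ => x ^ n.1 * y ^ n.2 :=
  (summable_geometric_of_lt_one hx hx1).mul_of_nonneg (summable_geometric_of_lt_one hy hy1)
    (fun _ => by positivity) (fun _ => by positivity)

lemma hasSum_taylor_one {u : ℂ → ℂ} (hu : DifferentiableOn ℂ u (Metric.ball 0 1)) {z : ℂ}
    (hz : ‖z‖ < 1) :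
    HasSum (fun n : ℕ => iteratedDeriv n u 0 / (n.factorial : ℂ) * z ^ n) (u z) := by
  have := Complex.hasSum_taylorSeries_on_ball hu (z := z) (by simpa using hz)
  refine this.congr_fun fun n => ?_
  simp only [sub_zero, smul_eq_mul]
  ring

lemma summable_norm_taylor {F : (Fin 2 → ℂ) → ℂ} (hF : AnalyticOnNhd ℂ F bidisc) {C : ℝ}
    (hC : ∀ z ∈ bidisc, ‖F z‖ ≤ C) {z w : ℂ} (hz : ‖z‖ < 1) (hw : ‖w‖ < 1) :
    Summable fun n : ℕ × ℕ => ‖taylorCoeff F n * (z ^ n.1 * w ^ n.2)‖ := by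
  refine Summable.of_nonneg_of_le (fun _ => norm_nonneg _) (fun n => ?_)
    ((summable_pow_mul_pow (norm_nonneg z) hz (norm_nonneg w) hw).mul_left C)
  rw [norm_mul, norm_mul, norm_pow, norm_pow]
  gcongr
  exact norm_taylorCoeff_le hF hC n

/-- A bounded analytic function on the bidisc is the sum of its double Taylor series. -/
lemma hasSum_taylor {F : (Fin 2 → ℂ) → ℂ} (hF : AnalyticOnNhd ℂ F bidisc) {C : ℝ}
    (hC : ∀ z ∈ bidisc, ‖F z‖ ≤ C) {z w : ℂ} (hz : ‖z‖ < 1) (hw : ‖w‖ < 1) :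
    HasSum (fun n : ℕ × ℕ => taylorCoeff F n * (z ^ n.1 * w ^ n.2)) (F ![z, w]) := by
  have hs := (summable_norm_taylor hF hC hz hw).of_norm
  have hs' := (Equiv.prodComm ℕ ℕ).hasSum_iff.2 hs.hasSum
  have h1 := hs'.prod_fiberwise (g := fun n => iteratedDeriv n (fun w => F ![z, w]) 0 /
    (n.factorial : ℂ) * w ^ n) ?_
  · have h2 := hasSum_taylor_one (differentiableOn_slice_snd hF hz) hw
    rw [h2.unique h1]
    exact hs.hasSum
  · intro n
    have := (hasSum_taylor_one (differentiableOn_iteratedDeriv_snd hF n) hz).mul_right (w ^ n)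
    refine this.congr_fun fun m => ?_
    simp only [Function.comp, Equiv.prodComm_apply, Prod.swap_prod_mk, taylorCoeff_eq]
    ring

/-- The Taylor coefficients at the origin only depend on the function on the bidisc. -/
lemma taylorCoeff_congr {F G : (Fin 2 → ℂ) → ℂ} (h : ∀ z ∈ bidisc, F z = G z) (n : ℕ × ℕ) :
    taylorCoeff F n = taylorCoeff G n := by
  unfold taylorCoeff
  congr 1
  refine Filter.EventuallyEq.iteratedDeriv_eq _ ?_
  filter_upwards [Metric.ball_mem_nhds (0 : ℂ) one_pos] with z hz
  refine Filter.EventuallyEq.iteratedDeriv_eq _ ?_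
  filter_upwards [Metric.ball_mem_nhds (0 : ℂ) one_pos] with w hw
  exact h _ (vec_mem_bidisc (by simpa using hz) (by simpa using hw))

lemma iteratedDeriv_sub_of_differentiableOn {u v : ℂ → ℂ}
    (hu : DifferentiableOn ℂ u (Metric.ball 0 1)) (hv : DifferentiableOn ℂ v (Metric.ball 0 1))
    (n : ℕ) :
    iteratedDeriv n (fun z => u z - v z) 0 = iteratedDeriv n u 0 - iteratedDeriv n v 0 := by
  have hb : Metric.ball (0 : ℂ) 1 ∈ 𝓝 (0 : ℂ) := Metric.ball_mem_nhds _ one_pos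
  exact iteratedDeriv_fun_sub (hu.analyticAt hb).contDiffAt (hv.analyticAt hb).contDiffAt

lemma taylorCoeff_sub {F G : (Fin 2 → ℂ) → ℂ} (hF : AnalyticOnNhd ℂ F bidisc)
    (hG : AnalyticOnNhd ℂ G bidisc) (n : ℕ × ℕ) :
    taylorCoeff (fun z => F z - G z) n = taylorCoeff F n - taylorCoeff G n := by
  simp only [taylorCoeff_eq]
  rw [← sub_div, ← iteratedDeriv_sub_of_differentiableOn (differentiableOn_iteratedDeriv_snd hF n.2)
    (differentiableOn_iteratedDeriv_snd hG n.2)]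
  congr 1
  refine Filter.EventuallyEq.iteratedDeriv_eq _ ?_
  filter_upwards [Metric.ball_mem_nhds (0 : ℂ) one_pos] with z hz
  have hz' : ‖z‖ < 1 := by simpa using hz
  rw [← sub_div, ← iteratedDeriv_sub_of_differentiableOn (differentiableOn_slice_snd hF hz')
    (differentiableOn_slice_snd hG hz')]

/-! ### Parseval's identity and Hardy norms -/

/-- Lebesgue measure on the square `(0, 2π]²` of angles, of total mass `(2π)²`. -/
noncomputable def angleMeasure : Measure (Fin 2 → ℝ) :=
  volume.restrict (Set.univ.pi fun _ => Set.Ioc 0 (2 * Real.pi))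

lemma angleMeasure_eq_pi :
    angleMeasure = Measure.pi fun _ : Fin 2 => volume.restrict (Set.Ioc 0 (2 * Real.pi)) := by
  rw [angleMeasure, volume_pi, Measure.restrict_pi_pi]

instance : IsFiniteMeasure angleMeasure := by
  rw [angleMeasure_eq_pi]; infer_instance

lemma measureReal_angleMeasure : angleMeasure.real Set.univ = (2 * Real.pi) ^ 2 := by
  rw [angleMeasure_eq_pi, Measure.real, Measure.pi_univ]
  simp [ENNReal.toReal_mul, sq, Real.pi_nonneg]

/-- The character `θ ↦ exp (i (n₁ θ₀ + n₂ θ₁))` with nonnegative frequencies. -/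
noncomputable def character (n : ℕ × ℕ) (θ : Fin 2 → ℝ) : ℂ :=
  Complex.exp (θ 0 * Complex.I) ^ n.1 * Complex.exp (θ 1 * Complex.I) ^ n.2

lemma continuous_character (n : ℕ × ℕ) : Continuous (character n) := by
  unfold character; fun_prop

lemma norm_character (n : ℕ × ℕ) (θ : Fin 2 → ℝ) : ‖character n θ‖ = 1 := by
  simp [character, Complex.norm_exp_ofReal_mul_I]

lemma integral_exp_pow_mul_conj (m n : ℕ) :
    ∫ x in Set.Ioc 0 (2 * Real.pi), Complex.exp ((x : ℝ) * Complex.I) ^ m *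
      (starRingEnd ℂ) (Complex.exp (x * Complex.I) ^ n) =
      if m = n then ((2 * Real.pi : ℝ) : ℂ) else 0 := by
  rw [← intervalIntegral.integral_of_le (by positivity)]
  have h : ∀ x : ℝ, Complex.exp ((x : ℝ) * Complex.I) ^ m *
      (starRingEnd ℂ) (Complex.exp (x * Complex.I) ^ n) =
      Complex.exp ((((m : ℤ) - n : ℤ) : ℂ) * Complex.I * x) := by
    intro x
    rw [map_pow, ← Complex.exp_conj, ← Complex.exp_nat_mul, ← Complex.exp_nat_mul,
      ← Complex.exp_add]
    congr 1
    simp only [map_mul, Complex.conj_ofReal, Complex.conj_I]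
    push_cast
    ring
  simp_rw [h]
  split_ifs with hmn
  · subst hmn
    simp
  · have hne : (((m : ℤ) - n : ℤ) : ℂ) ≠ 0 := by
      rw [Int.cast_ne_zero]; omega
    rw [integral_exp_mul_complex (mul_ne_zero hne Complex.I_ne_zero)]
    have h2 : Complex.exp ((((m : ℤ) - n : ℤ) : ℂ) * Complex.I * ((2 * Real.pi : ℝ) : ℂ)) = 1 := by
      rw [← Complex.exp_int_mul_two_pi_mul_I ((m : ℤ) - n)]
      congr 1
      push_cast
      ring
    rw [h2]
    simp

/-- Orthogonality of the characters. -/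
lemma integral_character_mul_conj (m n : ℕ × ℕ) :
    ∫ θ, character m θ * (starRingEnd ℂ) (character n θ) ∂angleMeasure =
      if m = n then (((2 * Real.pi) ^ 2 : ℝ) : ℂ) else 0 := by
  have h : ∀ θ : Fin 2 → ℝ, character m θ * (starRingEnd ℂ) (character n θ) =
      ∏ i : Fin 2, (fun (i : Fin 2) (x : ℝ) => Complex.exp (x * Complex.I) ^ (![m.1, m.2] i) *
        (starRingEnd ℂ) (Complex.exp (x * Complex.I) ^ (![n.1, n.2] i))) i (θ i) := by
    intro θ
    simp only [character, Fin.prod_univ_two, map_mul, Matrix.cons_val_zero, Matrix.cons_val_one]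
    ring
  rw [integral_congr_ae (Eventually.of_forall h), angleMeasure_eq_pi,
    integral_fintype_prod_eq_prod (fun (i : Fin 2) (x : ℝ) =>
      Complex.exp (x * Complex.I) ^ (![m.1, m.2] i) *
        (starRingEnd ℂ) (Complex.exp (x * Complex.I) ^ (![n.1, n.2] i))),
    Fin.prod_univ_two, integral_exp_pow_mul_conj, integral_exp_pow_mul_conj]
  simp only [Matrix.cons_val_zero, Matrix.cons_val_one, Prod.ext_iff]
  by_cases h1 : m.1 = n.1 <;> by_cases h2 : m.2 = n.2 <;> simp [h1, h2, sq]

lemma integrable_of_continuous_of_norm_le {E : Type*} [NormedAddCommGroup E]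
    {u : (Fin 2 → ℝ) → E} (hu : Continuous u) {C : ℝ}
    (hC : ∀ θ, ‖u θ‖ ≤ C) : Integrable u angleMeasure :=
  Integrable.of_bound (hu.aestronglyMeasurable) C
    (Eventually.of_forall hC)

lemma integral_norm_sq_sum_character (b : ℕ × ℕ → ℂ) (s : Finset (ℕ × ℕ)) :
    ∫ θ, ‖∑ n ∈ s, b n * character n θ‖ ^ 2 ∂angleMeasure =
      (2 * Real.pi) ^ 2 * ∑ n ∈ s, ‖b n‖ ^ 2 := by
  have h : ∀ θ, ((‖∑ n ∈ s, b n * character n θ‖ ^ 2 : ℝ) : ℂ) =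
      ∑ m ∈ s, ∑ n ∈ s, b m * (starRingEnd ℂ) (b n) *
        (character m θ * (starRingEnd ℂ) (character n θ)) := by
    intro θ
    rw [Complex.ofReal_pow, ← Complex.mul_conj', map_sum, Finset.sum_mul_sum]
    refine Finset.sum_congr rfl fun m _ => Finset.sum_congr rfl fun n _ => ?_
    rw [map_mul]
    ring
  have hint : ∀ m n : ℕ × ℕ, Integrable (fun θ => b m * (starRingEnd ℂ) (b n) *
        (character m θ * (starRingEnd ℂ) (character n θ))) angleMeasure := by
    intro m n
    refine Integrable.const_mul (integrable_of_continuous_of_norm_le (C := 1) ?_ ?_) _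
    · exact (continuous_character m).mul (Complex.continuous_conj.comp (continuous_character n))
    · intro θ; simp [norm_character]
  apply Complex.ofReal_injective
  rw [← integral_complex_ofReal]
  simp_rw [h]
  rw [integral_finsetSum _ fun m _ => integrable_finsetSum _ fun n _ => hint m n]
  simp_rw [integral_finsetSum _ fun n _ => hint _ n, integral_const_mul,
    integral_character_mul_conj]
  simp only [mul_ite, mul_zero, Finset.sum_ite_eq, Complex.mul_conj']
  push_cast
  rw [Finset.mul_sum]
  refine Finset.sum_congr rfl fun m hm => ?_
  simp [hm]
  ring

/-- Parseval's identity for absolutely convergent Fourier series with nonnegative frequencies. -/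
lemma hasSum_norm_sq_character {b : ℕ × ℕ → ℂ} (hb : Summable fun n => ‖b n‖)
    {u : (Fin 2 → ℝ) → ℂ} (hu : ∀ θ, HasSum (fun n => b n * character n θ) (u θ)) :
    HasSum (fun n => (2 * Real.pi) ^ 2 * ‖b n‖ ^ 2) (∫ θ, ‖u θ‖ ^ 2 ∂angleMeasure) := by
  have h := tendsto_integral_filter_of_dominated_convergence (μ := angleMeasure)
    (l := (atTop : Filter (Finset (ℕ × ℕ))))
    (F := fun s θ => ‖∑ n ∈ s, b n * character n θ‖ ^ 2) (f := fun θ => ‖u θ‖ ^ 2)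
    (fun _ => (∑' n, ‖b n‖) ^ 2) ?_ ?_ (integrable_const _) ?_
  · simp_rw [integral_norm_sq_sum_character, Finset.mul_sum] at h
    exact h
  · refine Eventually.of_forall fun s => Continuous.aestronglyMeasurable ?_
    exact ((continuous_finsetSum _ fun n _ =>
      continuous_const.mul (continuous_character n)).norm.pow 2)
  · refine Eventually.of_forall fun s => Eventually.of_forall fun θ => ?_
    rw [norm_pow, norm_norm]
    gcongr
    calc ‖∑ n ∈ s, b n * character n θ‖ ≤ ∑ n ∈ s, ‖b n * character n θ‖ := norm_sum_le _ _
      _ = ∑ n ∈ s, ‖b n‖ := by simp [norm_character]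
      _ ≤ _ := hb.sum_le_tsum _ fun _ _ => norm_nonneg _
  · exact Eventually.of_forall fun θ => ((hu θ).norm.pow 2)

/-- The point of the torus of radius `r` with angles `θ`. -/
noncomputable def circlePoint (r : ℝ) (θ : Fin 2 → ℝ) : Fin 2 → ℂ :=
  ![r * Complex.exp (θ 0 * Complex.I), r * Complex.exp (θ 1 * Complex.I)]

lemma norm_mul_exp_lt_one {r : ℝ} (h0 : 0 ≤ r) (h1 : r < 1) (x : ℝ) :
    ‖(r : ℂ) * Complex.exp (x * Complex.I)‖ < 1 := by
  rw [norm_mul, Complex.norm_exp_ofReal_mul_I, mul_one, Complex.norm_real,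
    Real.norm_of_nonneg h0]
  exact h1

lemma circlePoint_mem_bidisc {r : ℝ} (h0 : 0 ≤ r) (h1 : r < 1) (θ : Fin 2 → ℝ) :
    circlePoint r θ ∈ bidisc :=
  vec_mem_bidisc (norm_mul_exp_lt_one h0 h1 _) (norm_mul_exp_lt_one h0 h1 _)

/-- Parseval's identity on the torus of radius `r < 1`. -/
lemma hasSum_norm_sq_taylorCoeff_mul_pow {F : (Fin 2 → ℂ) → ℂ} (hF : AnalyticOnNhd ℂ F bidisc)
    {C : ℝ} (hC : ∀ z ∈ bidisc, ‖F z‖ ≤ C) {r : ℝ} (h0 : 0 ≤ r) (h1 : r < 1) :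
    HasSum (fun n : ℕ × ℕ => (2 * Real.pi) ^ 2 * (‖taylorCoeff F n‖ ^ 2 * (r ^ (n.1 + n.2)) ^ 2))
      (∫ θ, ‖F (circlePoint r θ)‖ ^ 2 ∂angleMeasure) := by
  have hr : ‖(r : ℂ)‖ < 1 := by rwa [Complex.norm_real, Real.norm_of_nonneg h0]
  have hb : Summable fun n : ℕ × ℕ => ‖taylorCoeff F n * (r : ℂ) ^ (n.1 + n.2)‖ := by
    refine (summable_norm_taylor hF hC hr hr).congr fun n => ?_
    rw [pow_add]
  have h := hasSum_norm_sq_character hb (u := fun θ => F (circlePoint r θ)) fun θ => ?_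
  · refine h.congr_fun fun n => ?_
    rw [norm_mul, norm_pow, Complex.norm_real, Real.norm_of_nonneg h0]
    ring
  · refine (hasSum_taylor hF hC (norm_mul_exp_lt_one h0 h1 (θ 0))
      (norm_mul_exp_lt_one h0 h1 (θ 1))).congr_fun fun n => ?_
    simp only [character]
    ring

/-- The Hardy norm is at most the supremum norm. -/
lemma sum_norm_sq_taylorCoeff_le {F : (Fin 2 → ℂ) → ℂ} (hF : AnalyticOnNhd ℂ F bidisc)
    {C : ℝ} (hC : ∀ z ∈ bidisc, ‖F z‖ ≤ C) (s : Finset (ℕ × ℕ)) :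
    ∑ n ∈ s, ‖taylorCoeff F n‖ ^ 2 ≤ C ^ 2 := by
  have hlim : Tendsto (fun r : ℝ => ∑ n ∈ s, ‖taylorCoeff F n‖ ^ 2 * (r ^ (n.1 + n.2)) ^ 2)
      (𝓝[<] 1) (𝓝 (∑ n ∈ s, ‖taylorCoeff F n‖ ^ 2)) := by
    have hc : Continuous
        (fun r : ℝ => ∑ n ∈ s, ‖taylorCoeff F n‖ ^ 2 * (r ^ (n.1 + n.2)) ^ 2) := by fun_prop
    simpa using (hc.tendsto 1).mono_left (nhdsWithin_le_nhds (s := Set.Iio 1))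
  refine le_of_tendsto hlim ?_
  filter_upwards [Ioo_mem_nhdsLT (show (0 : ℝ) < 1 by norm_num)] with r hr
  have h := hasSum_norm_sq_taylorCoeff_mul_pow hF hC hr.1.le hr.2
  have h1 := sum_le_hasSum s (fun _ _ => by positivity) h
  have h2 : ∫ θ, ‖F (circlePoint r θ)‖ ^ 2 ∂angleMeasure ≤ (2 * Real.pi) ^ 2 * C ^ 2 := by
    have h3 := norm_integral_le_of_norm_le_const (μ := angleMeasure)
      (f := fun θ => ‖F (circlePoint r θ)‖ ^ 2) (C := C ^ 2) (Eventually.of_forall fun θ => by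
        rw [norm_pow, norm_norm]
        gcongr
        exact hC _ (circlePoint_mem_bidisc hr.1.le hr.2 θ))
    rw [measureReal_angleMeasure, mul_comm] at h3
    exact (Real.le_norm_self _).trans h3
  rw [← Finset.mul_sum] at h1
  exact le_of_mul_le_mul_left (h1.trans h2) (by positivity)

lemma summable_norm_sq_taylorCoeff {F : (Fin 2 → ℂ) → ℂ} (hF : AnalyticOnNhd ℂ F bidisc)
    {C : ℝ} (hC : ∀ z ∈ bidisc, ‖F z‖ ≤ C) : Summable fun n => ‖taylorCoeff F n‖ ^ 2 :=
  summable_of_sum_le (fun _ => by positivity) (sum_norm_sq_taylorCoeff_le hF hC)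

/-- A rational inner function has Hardy norm at least `1`: its dilations converge boundedly almost
everywhere on the torus to a unimodular function. -/
lemma one_le_tsum_norm_sq_taylorCoeff {f : (Fin 2 → ℂ) → ℂ} (hf : IsRationalInner f) :
    1 ≤ ∑' n, ‖taylorCoeff f n‖ ^ 2 := by
  obtain ⟨q, d, hqd, hae⟩ := hf.rational_inner
  have hcont : ∀ r : ℝ, 0 ≤ r → r < 1 → Continuous fun θ => f (circlePoint r θ) := by
    intro r h0 h1
    rw [continuous_iff_continuousAt]
    intro θ
    have hc : Continuous fun θ => circlePoint r θ := by
      unfold circlePoint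
      refine continuous_pi fun i => ?_
      fin_cases i <;> simp <;> fun_prop
    exact (hf.schur.analytic _ (circlePoint_mem_bidisc h0 h1 θ)).continuousAt.comp
      (f := fun θ => circlePoint r θ) hc.continuousAt
  have hr : ∀ᶠ r : ℝ in 𝓝[<] 1, r ∈ Set.Ioo (0 : ℝ) 1 :=
    Ioo_mem_nhdsLT (show (0 : ℝ) < 1 by norm_num)
  have hlim := tendsto_integral_filter_of_dominated_convergence (μ := angleMeasure)
    (l := 𝓝[<] (1 : ℝ)) (F := fun r θ => ‖f (circlePoint r θ)‖ ^ 2) (f := fun _ => (1 : ℝ))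
    (fun _ => 1) ?_ ?_ (integrable_const _) ?_
  · rw [integral_const, measureReal_angleMeasure, smul_eq_mul, mul_one] at hlim
    have hle : (2 * Real.pi) ^ 2 ≤ (2 * Real.pi) ^ 2 * ∑' n, ‖taylorCoeff f n‖ ^ 2 := by
      refine le_of_tendsto hlim ?_
      filter_upwards [hr] with r hr
      have h := hasSum_norm_sq_taylorCoeff_mul_pow hf.schur.analytic hf.schur.norm_le_one
        hr.1.le hr.2
      have hs := (summable_norm_sq_taylorCoeff hf.schur.analytic hf.schur.norm_le_one).hasSum
      refine hasSum_le (fun n => ?_) h (hs.mul_left ((2 * Real.pi) ^ 2))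
      have : (r ^ (n.1 + n.2)) ^ 2 ≤ 1 :=
        pow_le_one₀ (pow_nonneg hr.1.le _) (pow_le_one₀ hr.1.le hr.2.le)
      gcongr
      exact mul_le_of_le_one_right (by positivity) this
    have hpi : (0 : ℝ) < (2 * Real.pi) ^ 2 := by positivity
    exact le_of_mul_le_mul_left (by simpa using hle) hpi
  · filter_upwards [hr] with r hr
    exact ((hcont r hr.1.le hr.2).norm.pow 2).aestronglyMeasurable
  · filter_upwards [hr] with r hr
    refine Eventually.of_forall fun θ => ?_
    rw [norm_pow, norm_norm]
    exact pow_le_one₀ (norm_nonneg _)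
      (hf.schur.norm_le_one _ (circlePoint_mem_bidisc hr.1.le hr.2 θ))
  · refine ae_restrict_of_ae ?_
    filter_upwards [hae] with θ hθ
    have hd : MvPolynomial.eval (torusMap 0 1 θ) d ≠ 0 := by
      -- otherwise the quotient would be `0` by the convention for division
      intro h0
      rw [h0, div_zero, norm_zero] at hθ
      exact zero_ne_one hθ
    have hpt : Tendsto (fun r : ℝ => circlePoint r θ) (𝓝[<] 1) (𝓝 (torusMap 0 1 θ)) := by
      have hc : Continuous fun r : ℝ => circlePoint r θ := by
        unfold circlePoint
        refine continuous_pi fun i => ?_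
        fin_cases i <;> simp <;> fun_prop
      have h1 : circlePoint 1 θ = torusMap 0 1 θ := by
        ext i
        fin_cases i <;> simp [circlePoint, torusMap]
      rw [← h1]
      exact (hc.tendsto 1).mono_left nhdsWithin_le_nhds
    have h2 := ((MvPolynomial.continuous_eval q).continuousAt.tendsto.comp hpt).div
      ((MvPolynomial.continuous_eval d).continuousAt.tendsto.comp hpt) hd
    have h3 := h2.norm.pow 2
    rw [hθ, one_pow] at h3
    refine h3.congr' ?_
    filter_upwards [hr] with r hr
    rw [(hqd _ (circlePoint_mem_bidisc hr.1.le hr.2 θ)).2]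
    rfl

/-! ### Squarefree polynomials and division in one variable -/

open Polynomial nonZeroDivisors in
/-- By Gauss's lemma, a squarefree polynomial over a factorial domain stays squarefree over the
fraction field. -/
lemma squarefree_map_fractionRing {R : Type*} [CommRing R] [IsDomain R]
    [UniqueFactorizationMonoid R] {p : R[X]} (hp : Squarefree p) :
    Squarefree (p.map (algebraMap R (FractionRing R))) := by
  let : StrongNormalizationMonoid R := UniqueFactorizationMonoid.strongNormalizationMonoid
  let : NormalizedGCDMonoid R := UniqueFactorizationMonoid.toNormalizedGCDMonoid R
  have hinj : Function.Injective (algebraMap R (FractionRing R)) := IsFractionRing.injective _ _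
  intro q hq
  have hq0 : q ≠ 0 := by
    rintro rfl
    rw [zero_mul, zero_dvd_iff, Polynomial.map_eq_zero_iff hinj] at hq
    exact hp.ne_zero hq
  set N := IsLocalization.integerNormalization R⁰ q with hN
  have hN0 : N ≠ 0 := by
    rwa [hN, Ne, IsLocalization.integerNormalization_eq_zero_iff le_rfl]
  obtain ⟨b, hb, hbN⟩ := IsLocalization.integerNormalization_spec R⁰ q
  have hdvd : N.primPart.map (algebraMap R (FractionRing R)) ∣ q := by
    have hbu : IsUnit (C (algebraMap R (FractionRing R) b)) := by
      rw [isUnit_C, isUnit_iff_ne_zero, Ne, map_eq_zero_iff _ hinj]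
      exact nonZeroDivisors.ne_zero hb
    rw [← hbu.dvd_mul_left, ← algebraMap_eq (R := FractionRing R),
      ← Algebra.smul_def, algebraMap_smul, ← hbN]
    exact Polynomial.map_dvd _ N.primPart_dvd
  refine isUnit_or_eq_zero_of_isUnit_integerNormalization_primPart hq0 (hp _ ?_)
  refine (N.isPrimitive_primPart.mul N.isPrimitive_primPart).dvd_of_fraction_map_dvd_fraction_map
    (K := FractionRing R) ?_
  rw [Polynomial.map_mul]
  exact (mul_dvd_mul hdvd hdvd).trans hq

open Polynomial nonZeroDivisors in
/-- A squarefree polynomial and its derivative satisfy a Bézout identity whose right-hand side is a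
nonzero constant polynomial (a multiple of the discriminant). -/
lemma exists_bezout_derivative {R : Type*} [CommRing R] [IsDomain R] [CharZero R]
    [UniqueFactorizationMonoid R] {p : R[X]} (hp : Squarefree p) :
    ∃ (a b : R[X]) (d : R), d ≠ 0 ∧ a * p + b * derivative p = C d := by
  have hinj : Function.Injective (algebraMap R (FractionRing R)) := IsFractionRing.injective _ _
  have : CharZero (FractionRing R) := charZero_of_injective_algebraMap hinj
  obtain ⟨u, v, huv⟩ := PerfectField.separable_iff_squarefree.2 (squarefree_map_fractionRing hp)
  obtain ⟨s, hs, hsu⟩ := IsLocalization.integerNormalization_spec R⁰ u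
  obtain ⟨t, ht, htv⟩ := IsLocalization.integerNormalization_spec R⁰ v
  refine ⟨C t * IsLocalization.integerNormalization R⁰ u,
    C s * IsLocalization.integerNormalization R⁰ v, s * t,
    mul_ne_zero (nonZeroDivisors.ne_zero hs) (nonZeroDivisors.ne_zero ht), ?_⟩
  apply Polynomial.map_injective _ hinj
  have hsm : ∀ (r : R) (w : (FractionRing R)[X]), r • w = C (algebraMap R (FractionRing R) r) * w :=
    fun r w => by rw [← algebraMap_eq (R := FractionRing R), ← Algebra.smul_def, algebraMap_smul]
  simp only [Polynomial.map_add, Polynomial.map_mul, map_C, hsu, htv, hsm, map_mul]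
  rw [derivative_map] at huv
  linear_combination (C (algebraMap R (FractionRing R) s) *
    C (algebraMap R (FractionRing R) t)) * huv

lemma finSuccEquiv_squarefree {p : MvPolynomial (Fin 2) ℂ} (hp : Squarefree p) :
    Squarefree (MvPolynomial.finSuccEquiv ℂ 1 p) := by
  set e := MvPolynomial.finSuccEquiv ℂ 1
  intro q hq
  have h := map_dvd e.symm hq
  rw [map_mul, AlgEquiv.symm_apply_apply] at h
  have := (hp _ h).map e
  rwa [AlgEquiv.apply_symm_apply] at this

/-- For all parameters `t` off the zero set of a nonzero polynomial, the slice `p (·, t)` has only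
simple roots. -/
lemma exists_separable_slices {p : MvPolynomial (Fin 2) ℂ} (hp : Squarefree p) :
    ∃ d : MvPolynomial (Fin 1) ℂ, d ≠ 0 ∧ ∀ t : ℂ, MvPolynomial.eval (fun _ => t) d ≠ 0 →
      ∃ Q : Polynomial ℂ, Q.Separable ∧ ∀ x, MvPolynomial.eval ![x, t] p = Q.eval x := by
  obtain ⟨a, b, d, hd, hab⟩ := exists_bezout_derivative (finSuccEquiv_squarefree hp)
  refine ⟨d, hd, fun t ht =>
    ⟨(MvPolynomial.finSuccEquiv ℂ 1 p).map (MvPolynomial.eval fun _ => t), ?_, fun x => ?_⟩⟩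
  · have h := congrArg (Polynomial.map (MvPolynomial.eval fun _ => t)) hab
    simp only [Polynomial.map_add, Polynomial.map_mul, Polynomial.map_C] at h
    set c := MvPolynomial.eval (fun _ => t) d
    refine ⟨Polynomial.C c⁻¹ * a.map (MvPolynomial.eval fun _ => t),
      Polynomial.C c⁻¹ * b.map (MvPolynomial.eval fun _ => t), ?_⟩
    rw [Polynomial.derivative_map, mul_assoc, mul_assoc, ← mul_add, h, ← Polynomial.C_mul,
      inv_mul_cancel₀ ht, Polynomial.C_1]
  · rw [← MvPolynomial.eval_eq_eval_mv_eval']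
    congr 2
    ext i
    fin_cases i <;> rfl

/-- The nonvanishing set of a nonzero polynomial is dense. -/
lemma dense_eval_ne_zero {σ : Type*} [Fintype σ] {p : MvPolynomial σ ℂ} (hp : p ≠ 0) :
    Dense {z : σ → ℂ | MvPolynomial.eval z p ≠ 0} := by
  intro a
  by_contra h
  rw [mem_closure_iff_frequently, not_frequently] at h
  apply hp
  refine MvPolynomial.funext fun z => ?_
  have := AnalyticOnNhd.eq_of_eventuallyEq (AnalyticOnNhd.eval_mvPolynomial p)
    (analyticOnNhd_const (v := (0 : ℂ))) (z₀ := a) (by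
      filter_upwards [h] with z hz
      simpa using hz)
  simpa using congrFun this z

/-- An analytic function vanishing at finitely many points is divisible by the product of the
corresponding linear factors. -/
lemma exists_eq_prod_mul {U : Set ℂ} (hU : IsOpen U) {φ : ℂ → ℂ} (hφ : DifferentiableOn ℂ φ U)
    (S : Finset ℂ) (hS : ∀ α ∈ S, α ∈ U → φ α = 0) :
    ∃ ψ : ℂ → ℂ, DifferentiableOn ℂ ψ U ∧ ∀ x ∈ U, φ x = (∏ α ∈ S, (x - α)) * ψ x := by
  classical
  induction S using Finset.induction_on with
  | empty => exact ⟨φ, hφ, by simp⟩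
  | insert β S hβ ih =>
    obtain ⟨ψ, hψ, h⟩ := ih fun α hα => hS α (Finset.mem_insert_of_mem hα)
    by_cases hβU : β ∈ U
    · refine ⟨dslope ψ β, (Complex.differentiableOn_dslope (hU.mem_nhds hβU)).2 hψ,
        fun x hx => ?_⟩
      have hψβ : ψ β = 0 := by
        have h1 := h β hβU
        rw [hS β (Finset.mem_insert_self _ _) hβU, eq_comm, mul_eq_zero] at h1
        refine h1.resolve_left (Finset.prod_ne_zero_iff.2 fun α hα => sub_ne_zero.2 ?_)
        rintro rfl
        exact hβ hα
      have h2 := sub_smul_dslope ψ β x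
      rw [hψβ, sub_zero, smul_eq_mul] at h2
      rw [h x hx, Finset.prod_insert hβ, ← h2]
      ring
    · have hne : ∀ x ∈ U, x - β ≠ 0 := fun x hx => sub_ne_zero.2 fun hxβ => hβU (hxβ ▸ hx)
      refine ⟨fun x => ψ x / (x - β), hψ.div (by fun_prop) hne, fun x hx => ?_⟩
      rw [h x hx, Finset.prod_insert hβ]
      field_simp [hne x hx]

lemma exists_eq_eval_mul {U : Set ℂ} (hU : IsOpen U) {φ : ℂ → ℂ} (hφ : DifferentiableOn ℂ φ U)
    {Q : Polynomial ℂ} (hQ : Q.Separable) (h0 : ∀ α ∈ U, Q.eval α = 0 → φ α = 0) :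
    ∃ ψ : ℂ → ℂ, DifferentiableOn ℂ ψ U ∧ ∀ x ∈ U, φ x = Q.eval x * ψ x := by
  classical
  obtain ⟨ψ, hψ, h⟩ := exists_eq_prod_mul hU hφ Q.roots.toFinset fun α hα hαU =>
    h0 α hαU (Polynomial.isRoot_of_mem_roots (Multiset.mem_toFinset.1 hα))
  have hlc : Q.leadingCoeff ≠ 0 := Polynomial.leadingCoeff_ne_zero.2 hQ.ne_zero
  refine ⟨fun x => Q.leadingCoeff⁻¹ * ψ x, hψ.const_mul _, fun x hx => ?_⟩
  have hev : Q.eval x = Q.leadingCoeff * ∏ α ∈ Q.roots.toFinset, (x - α) := by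
    conv_lhs => rw [(IsAlgClosed.splits Q).eq_prod_roots]
    rw [Polynomial.eval_mul, Polynomial.eval_C, Polynomial.eval_multiset_prod, Multiset.map_map,
      Finset.prod, Multiset.toFinset_val, (Polynomial.nodup_roots hQ).dedup]
    simp
  rw [hev, h x hx]
  field_simp

/-! ### Cauchy integrals with parameters -/

/-- A family `H x`, `x` in a compact space, of functions holomorphic in a disc and jointly
continuous up to the boundary is an analytic curve in the Banach space `C(X, ℂ)`. It is given there
by the vector-valued Cauchy integral. -/
lemma exists_analyticAt_continuousMap {X : Type*} [TopologicalSpace X] [CompactSpace X]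
    (H : X → ℂ → ℂ) (t₀ : ℂ) {r : ℝ} (hr : 0 < r)
    (hc : ContinuousOn (fun z : ℂ × X => H z.2 z.1) (Metric.closedBall t₀ r ×ˢ Set.univ))
    (hd : ∀ x, DifferentiableOn ℂ (H x) (Metric.closedBall t₀ r)) :
    ∃ Ψ : ℂ → C(X, ℂ), AnalyticAt ℂ Ψ t₀ ∧ ∀ t ∈ Metric.ball t₀ r, ∀ x, Ψ t x = H x t := by
  classical
  have hK0 : Continuous fun z : Metric.closedBall t₀ r × X => H z.2 z.1 := by
    refine hc.comp_continuous (f := fun z : Metric.closedBall t₀ r × X => ((z.1 : ℂ), z.2))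
      (by fun_prop) fun z => ⟨z.1.2, Set.mem_univ _⟩
  let K₀ : C(Metric.closedBall t₀ r, C(X, ℂ)) := ContinuousMap.curry ⟨_, hK0⟩
  let K : ℂ → C(X, ℂ) := fun τ => if h : τ ∈ Metric.closedBall t₀ r then K₀ ⟨τ, h⟩ else 0
  have hKx : ∀ τ ∈ Metric.closedBall t₀ r, ∀ x, K τ x = H x τ := by
    intro τ hτ x
    simp only [K, dif_pos hτ]
    rfl
  have hKc : ContinuousOn K (Metric.closedBall t₀ r) := by
    rw [continuousOn_iff_continuous_domRestrict]
    convert K₀.continuous using 1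
    ext τ x
    simp only [Set.domRestrict_apply, K, dif_pos τ.2]
  lift r to NNReal using hr.le
  have hKi : CircleIntegrable K t₀ r :=
    (hKc.mono Metric.sphere_subset_closedBall).circleIntegrable hr.le
  refine ⟨_, (hasFPowerSeriesOn_cauchy_integral hKi (by exact_mod_cast hr)).analyticAt,
    fun t ht x => ?_⟩
  have hdc : DiffContOnCl ℂ (H x) (Metric.ball t₀ r) := by
    refine DifferentiableOn.diffContOnCl ((hd x).mono ?_)
    exact Metric.closure_ball_subset_closedBall
  have hcauchy := hdc.circleIntegral_sub_inv_smul ht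
  have hint : IntervalIntegrable (fun θ => deriv (circleMap t₀ r) θ •
      ((circleMap t₀ r θ - t)⁻¹ • K (circleMap t₀ r θ))) volume 0 (2 * Real.pi) := by
    refine CircleIntegrable.out (f := fun z => (z - t)⁻¹ • K z) ?_
    have hinv : ContinuousOn (fun z : ℂ => (z - t)⁻¹) (Metric.sphere t₀ r) := by
      refine ContinuousOn.inv₀ (by fun_prop) fun z hz => sub_ne_zero.2 ?_
      rintro rfl
      rw [Metric.mem_sphere] at hz
      rw [Metric.mem_ball, hz] at ht
      exact lt_irrefl _ ht
    exact (hinv.smul (hKc.mono Metric.sphere_subset_closedBall)).circleIntegrable hr.le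
  have heval := (ContinuousMap.evalCLM ℂ x).intervalIntegral_comp_comm hint
  have heq : (∮ z in C(t₀, r), (z - t)⁻¹ • K z) x = ∮ z in C(t₀, r), (z - t)⁻¹ • H x z := by
    rw [circleIntegral, circleIntegral]
    refine heval.symm.trans ?_
    refine intervalIntegral.integral_congr fun θ _ => ?_
    have hmem : circleMap t₀ r θ ∈ Metric.closedBall t₀ r :=
      circleMap_mem_closedBall _ hr.le θ
    simp only [ContinuousMap.evalCLM_apply, ContinuousMap.smul_apply, hKx _ hmem]
  rw [ContinuousMap.smul_apply, heq, hcauchy, smul_smul, inv_mul_cancel₀ Complex.two_pi_I_ne_zero,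
    one_smul]

/-- The functional `φ ↦ ∮ φ dζ` on `C(S, ℂ)`, `S` the circle of radius `ρ` about the origin. -/
noncomputable def circleIntegralCLM (ρ : ℝ) (hρ : 0 ≤ ρ) :
    C(Metric.sphere (0 : ℂ) ρ, ℂ) →L[ℂ] ℂ :=
  LinearMap.mkContinuous
    { toFun := fun φ => ∫ θ in (0 : ℝ)..2 * Real.pi,
        deriv (circleMap 0 ρ) θ • φ ⟨circleMap 0 ρ θ, circleMap_mem_sphere 0 hρ θ⟩
      map_add' := fun φ ψ => by
        rw [← intervalIntegral.integral_add]
        · simp [mul_add]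
        all_goals
          refine Continuous.intervalIntegrable ?_ _ _
          simp only [deriv_circleMap]
          fun_prop
      map_smul' := fun c φ => by
        rw [RingHom.id_apply, ← intervalIntegral.integral_smul]
        refine intervalIntegral.integral_congr fun θ _ => ?_
        simp only [ContinuousMap.smul_apply, smul_eq_mul]
        ring }
    (ρ * |2 * Real.pi - 0|) fun φ => by
      rw [mul_right_comm]
      refine intervalIntegral.norm_integral_le_of_norm_le_const fun θ _ => ?_
      rw [norm_smul, deriv_circleMap]
      simp only [norm_mul, norm_circleMap_zero, Complex.norm_I, mul_one, abs_of_nonneg hρ]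
      gcongr
      exact φ.norm_coe_le_norm _

lemma circleIntegralCLM_apply {ρ : ℝ} (hρ : 0 ≤ ρ) (φ : C(Metric.sphere (0 : ℂ) ρ, ℂ)) {u : ℂ → ℂ}
    (h : ∀ ζ : Metric.sphere (0 : ℂ) ρ, φ ζ = u ζ) :
    circleIntegralCLM ρ hρ φ = ∮ ζ in C(0, ρ), u ζ := by
  refine intervalIntegral.integral_congr fun θ _ => ?_
  simp only [h]

/-! ### Division on the bidisc -/

/-- An inner variety has no points with `‖z₀‖ = 1` and `‖z₁‖ < 1`. -/
lemma IsInnerVariety.notMem_of_norm_eq_one {V : Set (Fin 2 → ℂ)} (hV : IsInnerVariety V)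
    {x t : ℂ} (hx : ‖x‖ = 1) (ht : ‖t‖ < 1) : ![x, t] ∉ V := by
  intro h
  have hfr : ![x, t] ∈ frontier bidisc := by
    rw [isOpen_bidisc.frontier_eq]
    refine ⟨?_, fun hb => ?_⟩
    · have hc : Tendsto (fun s : ℝ => ![(s : ℂ) * x, t]) (𝓝[<] 1) (𝓝 ![x, t]) := by
        have hcont : Continuous fun s : ℝ => ![(s : ℂ) * x, t] := by
          refine continuous_pi fun i => ?_
          fin_cases i <;> simp <;> fun_prop
        simpa using (hcont.tendsto 1).mono_left (nhdsWithin_le_nhds (s := Set.Iio 1))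
      refine mem_closure_of_tendsto hc ?_
      filter_upwards [Ioo_mem_nhdsLT (show (0 : ℝ) < 1 by norm_num)] with s hs
      refine vec_mem_bidisc ?_ ht
      rw [norm_mul, hx, mul_one, Complex.norm_real, Real.norm_of_nonneg hs.1.le]
      exact hs.2
    · have := hb 0
      simp [hx] at this
  have := hV.exits ⟨h, hfr⟩ 1
  simp only [Matrix.cons_val_one, Matrix.cons_val_zero] at this
  exact ht.ne this

/-- Slightly smaller circles `‖x‖ = ρ` still avoid the inner variety, uniformly for `t` in a compact
disc. -/
lemma exists_radius {p : MvPolynomial (Fin 2) ℂ} (hV : IsInnerVariety (zeroSet p))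
    {t₀ : ℂ} {r R : ℝ} (hr : ‖t₀‖ + r < 1) (hR : R < 1) :
    ∃ ρ : ℝ, R < ρ ∧ 0 < ρ ∧ ρ < 1 ∧ ∀ x t : ℂ, ‖x‖ = ρ → t ∈ Metric.closedBall t₀ r →
      MvPolynomial.eval ![x, t] p ≠ 0 := by
  have hK : IsCompact (Metric.sphere (0 : ℂ) 1 ×ˢ Metric.closedBall t₀ r) :=
    (isCompact_sphere _ _).prod (isCompact_closedBall _ _)
  have hcont : Continuous fun z : ℝ × ℂ × ℂ =>
      MvPolynomial.eval ![(z.1 : ℂ) * z.2.1, z.2.2] p := by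
    refine (MvPolynomial.continuous_eval p).comp (continuous_pi fun i => ?_)
    fin_cases i <;> simp <;> fun_prop
  have hev := hK.eventually_forall_of_forall_eventually (x₀ := (1 : ℝ))
    (P := fun s z => MvPolynomial.eval ![(s : ℂ) * z.1, z.2] p ≠ 0) (fun z hz => by
      refine hcont.continuousAt.eventually_ne ?_
      have h1 : ‖z.1‖ = 1 := by simpa using hz.1
      have h2 : ‖z.2‖ < 1 := by
        have h3 : ‖z.2 - t₀‖ ≤ r := by simpa [dist_eq_norm] using hz.2
        have h4 := norm_le_norm_add_norm_sub' z.2 t₀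
        linarith
      simpa [zeroSet] using hV.notMem_of_norm_eq_one h1 h2)
  have hev' := hev.filter_mono (nhdsWithin_le_nhds (s := Set.Iio 1))
  obtain ⟨ρ, hρ, hρ1⟩ := (hev'.and
    (Ioo_mem_nhdsLT (show max R 0 < 1 from max_lt hR one_pos))).exists
  have hρ0 : 0 < ρ := (le_max_right _ _).trans_lt hρ1.1
  refine ⟨ρ, (le_max_left _ _).trans_lt hρ1.1, hρ0, hρ1.2, fun x t hx ht => ?_⟩
  have hρC : (ρ : ℂ) ≠ 0 := by exact_mod_cast hρ0.ne'
  have := hρ (x / ρ, t) ⟨by simp [hx, abs_of_pos hρ0, hρ0.ne'], ht⟩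
  rwa [mul_div_cancel₀ _ hρC] at this

/-- Local divisibility by `p` of analytic functions vanishing on the inner variety `Z_p`. The
quotient is the Cauchy integral of `F / p` in the first variable, over a circle that avoids `Z_p`;
where the slice of `p` has simple roots, it is the quotient by removability of singularities, and
the identity extends by density. -/
lemma exists_local_quotient {p : MvPolynomial (Fin 2) ℂ} (hp : Squarefree p)
    (hV : IsInnerVariety (zeroSet p)) {F : (Fin 2 → ℂ) → ℂ} (hF : AnalyticOnNhd ℂ F bidisc)
    (h0 : ∀ z ∈ zeroSet p ∩ bidisc, F z = 0) {a : Fin 2 → ℂ} (ha : a ∈ bidisc) :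
    ∃ g : (Fin 2 → ℂ) → ℂ, AnalyticAt ℂ g a ∧ ∀ᶠ z in 𝓝 a, F z = MvPolynomial.eval z p * g z := by
  obtain ⟨r, hr0, hr1⟩ : ∃ r : ℝ, 0 < r ∧ ‖a 1‖ + r < 1 :=
    ⟨(1 - ‖a 1‖) / 2, by linarith [ha 1], by linarith [ha 1]⟩
  obtain ⟨ρ, haρ, hρ0, hρ1, hρ⟩ := exists_radius hV hr1 (ha 0)
  obtain ⟨s, hs0, hs1⟩ : ∃ s : ℝ, 0 < s ∧ ‖a 0‖ + s < ρ :=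
    ⟨(ρ - ‖a 0‖) / 2, by linarith, by linarith⟩
  have hnorm : ∀ t ∈ Metric.closedBall (a 1) r, ‖t‖ < 1 := by
    intro t ht
    have h3 : ‖t - a 1‖ ≤ r := by simpa [dist_eq_norm] using ht
    have h4 := norm_le_norm_add_norm_sub' t (a 1)
    linarith
  have hnorm' : ∀ x ∈ Metric.closedBall (a 0) s, ‖x‖ < ρ := by
    intro x hx
    have h3 : ‖x - a 0‖ ≤ s := by simpa [dist_eq_norm] using hx
    have h4 := norm_le_norm_add_norm_sub' x (a 0)
    linarith
  have hvec : Continuous fun z : ℂ × ℂ => ![z.1, z.2] := by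
    refine continuous_pi fun i => ?_
    fin_cases i <;> simp <;> fun_prop
  -- the Cauchy kernel as an analytic curve in the space of continuous functions on the circle
  obtain ⟨Ψ₀, hΨ₀, hΨ₀x⟩ := exists_analyticAt_continuousMap
    (fun (ζ : Metric.sphere (0 : ℂ) ρ) (x : ℂ) => ((ζ : ℂ) - x)⁻¹) (a 0) hs0
    (by
      refine ContinuousOn.inv₀ (by fun_prop) fun z hz => sub_ne_zero.2 fun h => ?_
      have h1 := hnorm' _ hz.1
      have h2 : ‖(z.2 : ℂ)‖ = ρ := by simp
      rw [← h, h2] at h1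
      exact lt_irrefl _ h1)
    (fun ζ => by
      refine DifferentiableOn.inv (by fun_prop) fun z hz => sub_ne_zero.2 fun h => ?_
      have h1 := hnorm' _ hz
      have h2 : ‖(ζ : ℂ)‖ = ρ := by simp
      rw [← h, h2] at h1
      exact lt_irrefl _ h1)
  obtain ⟨Ψ₁, hΨ₁, hΨ₁t⟩ := exists_analyticAt_continuousMap
    (fun (ζ : Metric.sphere (0 : ℂ) ρ) (t : ℂ) => F ![(ζ : ℂ), t] / MvPolynomial.eval ![(ζ : ℂ), t] p)
    (a 1) hr0
    (by
      intro z hz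
      have h2 : ‖(z.2 : ℂ)‖ = ρ := by simp
      have hmap : Continuous fun z : ℂ × Metric.sphere (0 : ℂ) ρ => ![(z.2 : ℂ), z.1] :=
        hvec.comp (g := fun z : ℂ × ℂ => ![z.1, z.2])
          (f := fun z : ℂ × Metric.sphere (0 : ℂ) ρ => ((z.2 : ℂ), z.1)) (by fun_prop)
      have hFc : ContinuousAt (fun z : ℂ × Metric.sphere (0 : ℂ) ρ => F ![(z.2 : ℂ), z.1]) z :=
        ContinuousAt.comp (f := fun z : ℂ × Metric.sphere (0 : ℂ) ρ => ![(z.2 : ℂ), z.1])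
          (hF _ (vec_mem_bidisc (h2.trans_lt hρ1) (hnorm _ hz.1))).continuousAt hmap.continuousAt
      exact (hFc.div ((MvPolynomial.continuous_eval p).comp hmap).continuousAt
        (hρ _ _ h2 hz.1)).continuousWithinAt)
    (fun ζ => by
      have h2 : ‖(ζ : ℂ)‖ = ρ := by simp
      have hpa : AnalyticOnNhd ℂ (fun z => MvPolynomial.eval z p) bidisc :=
        (AnalyticOnNhd.eval_mvPolynomial p).mono (Set.subset_univ _)
      have hsub : Metric.closedBall (a 1) r ⊆ Metric.ball 0 1 := fun t ht => by
        simpa using hnorm t ht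
      exact ((differentiableOn_slice_snd hF (h2.trans_lt hρ1)).mono hsub).div
        ((differentiableOn_slice_snd hpa (h2.trans_lt hρ1)).mono hsub)
        fun t ht => hρ _ _ h2 ht)
  let g : (Fin 2 → ℂ) → ℂ := fun z =>
    (2 * Real.pi * Complex.I : ℂ)⁻¹ * circleIntegralCLM ρ hρ0.le (Ψ₀ (z 0) * Ψ₁ (z 1))
  have hg : ∀ x ∈ Metric.ball (a 0) s, ∀ t ∈ Metric.ball (a 1) r, g ![x, t] =
      (2 * Real.pi * Complex.I : ℂ)⁻¹ *
        ∮ ζ in C(0, ρ), (ζ - x)⁻¹ • (F ![ζ, t] / MvPolynomial.eval ![ζ, t] p) := by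
    intro x hx t ht
    simp only [g, Matrix.cons_val_zero, Matrix.cons_val_one]
    rw [circleIntegralCLM_apply hρ0.le _ fun ζ => ?_]
    rw [ContinuousMap.mul_apply, hΨ₀x x hx, hΨ₁t t ht, smul_eq_mul]
  have hproj : ∀ i : Fin 2, AnalyticAt ℂ (fun z : Fin 2 → ℂ => z i) a := fun i =>
    (ContinuousLinearMap.proj (R := ℂ) (φ := fun _ : Fin 2 => ℂ) i).analyticAt a
  have hga : AnalyticAt ℂ g a := by
    refine analyticAt_const.mul ?_
    refine ((circleIntegralCLM ρ hρ0.le).analyticAt _).comp ?_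
    exact (hΨ₀.comp (f := fun z : Fin 2 → ℂ => z 0) (hproj 0)).mul
      (hΨ₁.comp (f := fun z : Fin 2 → ℂ => z 1) (hproj 1))
  refine ⟨g, hga, ?_⟩
  obtain ⟨d, hd, hdQ⟩ := exists_separable_slices hp
  -- the identity on the dense set of parameters with simple roots
  have hsimple : ∀ x ∈ Metric.ball (a 0) s, ∀ t ∈ Metric.ball (a 1) r,
      MvPolynomial.eval (fun _ => t) d ≠ 0 →
      F ![x, t] = MvPolynomial.eval ![x, t] p * g ![x, t] := by
    intro x hx t ht htd
    have ht1 := hnorm t (Metric.ball_subset_closedBall ht)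
    have hxρ := hnorm' x (Metric.ball_subset_closedBall hx)
    obtain ⟨Q, hQ, hpQ⟩ := hdQ t htd
    obtain ⟨ψ, hψ, hFψ⟩ := exists_eq_eval_mul Metric.isOpen_ball (differentiableOn_slice_fst hF ht1)
      hQ fun α hα hQα => h0 _ ⟨by rw [zeroSet, Set.mem_ofPred_eq, hpQ, hQα],
        vec_mem_bidisc (by simpa using hα) ht1⟩
    have hcl : Metric.closedBall (0 : ℂ) ρ ⊆ Metric.ball 0 1 := Metric.closedBall_subset_ball hρ1
    have hdc : DiffContOnCl ℂ ψ (Metric.ball 0 ρ) :=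
      DifferentiableOn.diffContOnCl
        (hψ.mono (Metric.closure_ball_subset_closedBall.trans hcl))
    have hcauchy := hdc.circleIntegral_sub_inv_smul (w := x) (by simpa using hxρ)
    have hcongr : ∮ ζ in C(0, ρ), (ζ - x)⁻¹ • (F ![ζ, t] / MvPolynomial.eval ![ζ, t] p) =
        ∮ ζ in C(0, ρ), (ζ - x)⁻¹ • ψ ζ := by
      refine circleIntegral.integral_congr hρ0.le fun ζ hζ => ?_
      have hne := hρ ζ t (by simpa using hζ) (Metric.ball_subset_closedBall ht)
      have hmul := hFψ ζ (hcl (Metric.sphere_subset_closedBall hζ))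
      rw [← hpQ] at hmul
      rw [hmul, mul_div_cancel_left₀ _ hne]
    rw [hg x hx t ht, hcongr, hcauchy, smul_eq_mul,
      inv_mul_cancel_left₀ Complex.two_pi_I_ne_zero, hpQ]
    exact hFψ x (by simpa using hxρ.trans hρ1)
  -- extension by density and continuity
  have hnhds : ∀ᶠ z in 𝓝 a, AnalyticAt ℂ g z ∧ z 0 ∈ Metric.ball (a 0) s ∧
      z 1 ∈ Metric.ball (a 1) r ∧ z ∈ bidisc :=
    hga.eventually_analyticAt.and (((continuous_apply 0).continuousAt.eventually_mem
      (Metric.ball_mem_nhds _ hs0)).and (((continuous_apply 1).continuousAt.eventually_mem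
      (Metric.ball_mem_nhds _ hr0)).and (isOpen_bidisc.mem_nhds ha)))
  obtain ⟨W, hW, hWo, haW⟩ := eventually_nhds_iff.1 hnhds
  filter_upwards [hWo.mem_nhds haW] with z hz
  have hdense : Dense {z : Fin 2 → ℂ | MvPolynomial.eval (fun _ : Fin 1 => z 1) d ≠ 0} := by
    have hne : MvPolynomial.rename (fun _ : Fin 1 => (1 : Fin 2)) d ≠ 0 := by
      rw [Ne, map_eq_zero_iff _ (MvPolynomial.rename_injective _ fun i j _ => Subsingleton.elim i j)]
      exact hd
    have := dense_eval_ne_zero hne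
    simp only [MvPolynomial.eval_rename] at this
    exact this
  have hcl : z ∈ closure (W ∩ {z : Fin 2 → ℂ | MvPolynomial.eval (fun _ : Fin 1 => z 1) d ≠ 0}) :=
    hWo.inter_closure ⟨hz, hdense z⟩
  have hFz : ContinuousAt F z := (hF z (hW z hz).2.2.2).continuousAt
  have hpz : ContinuousAt (fun z => MvPolynomial.eval z p * g z) z :=
    (MvPolynomial.continuous_eval p).continuousAt.mul (hW z hz).1.continuousAt
  have := mem_closure_iff_nhdsWithin_neBot.1 hcl
  refine tendsto_nhds_unique_of_eventuallyEq
    (hFz.tendsto.mono_left (nhdsWithin_le_nhds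
      (s := W ∩ {z : Fin 2 → ℂ | MvPolynomial.eval (fun _ : Fin 1 => z 1) d ≠ 0})))
    (hpz.tendsto.mono_left nhdsWithin_le_nhds) ?_
  filter_upwards [self_mem_nhdsWithin] with y hy
  have hy' : ![y 0, y 1] = y := by ext i; fin_cases i <;> rfl
  have := hsimple (y 0) (hW y hy.1).2.1 (y 1) (hW y hy.1).2.2.1 hy.2
  rwa [hy'] at this

/-- Divisibility by `p` of analytic functions vanishing on the inner variety `Z_p`. The local
quotients agree on overlaps because `p` is nonzero on a dense set. -/
lemma exists_quotient {p : MvPolynomial (Fin 2) ℂ} (hp : Squarefree p)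
    (hV : IsInnerVariety (zeroSet p)) {F : (Fin 2 → ℂ) → ℂ} (hF : AnalyticOnNhd ℂ F bidisc)
    (h0 : ∀ z ∈ zeroSet p ∩ bidisc, F z = 0) :
    ∃ g : (Fin 2 → ℂ) → ℂ, AnalyticOnNhd ℂ g bidisc ∧
      ∀ z ∈ bidisc, F z = MvPolynomial.eval z p * g z := by
  set N : Set (Fin 2 → ℂ) := {z | MvPolynomial.eval z p ≠ 0} with hN
  have hdense : Dense N := dense_eval_ne_zero hp.ne_zero
  -- the limit exists and equals the local quotient near each point of the bidisc
  let g : (Fin 2 → ℂ) → ℂ := fun z => limUnder (𝓝[N] z) fun y => F y / MvPolynomial.eval y p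
  have key : ∀ a ∈ bidisc, AnalyticAt ℂ g a ∧ F a = MvPolynomial.eval a p * g a := by
    intro a ha
    obtain ⟨k, hk, hFk⟩ := exists_local_quotient hp hV hF h0 ha
    have hgk : g =ᶠ[𝓝 a] k := by
      filter_upwards [hk.eventually_analyticAt, hFk.eventually_nhds] with b hkb hFb
      have := mem_closure_iff_nhdsWithin_neBot.1 (hdense b)
      refine Tendsto.limUnder_eq ?_
      refine (hkb.continuousAt.tendsto.mono_left nhdsWithin_le_nhds).congr' ?_
      filter_upwards [self_mem_nhdsWithin, hFb.filter_mono nhdsWithin_le_nhds] with y hy hFy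
      rw [hFy, mul_div_cancel_left₀ _ hy]
    refine ⟨hk.congr hgk.symm, ?_⟩
    rw [hgk.self_of_nhds]
    exact hFk.self_of_nhds
  exact ⟨g, fun a ha => (key a ha).1, fun a ha => (key a ha).2⟩

end StrongPick

/-! ### Strong Pick sets -/

open StrongPick
theorem theorem3p1 (f : (Fin 2 → ℂ) → ℂ) (hf : IsRationalInner f)
    (p : MvPolynomial (Fin 2) ℂ) (hp : Squarefree p) (hV : IsInnerVariety (zeroSet p))
    (hineq : ∀ g : (Fin 2 → ℂ) → ℂ, AnalyticOnNhd ℂ g bidisc →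
      (∃ C : ℝ, ∀ z ∈ bidisc, ‖MvPolynomial.eval z p * g z‖ ≤ C) →
      (∃ z ∈ bidisc, g z ≠ 0) →
      2 * (hardyInner f (fun z => MvPolynomial.eval z p * g z)).re <
        hardyNorm (fun z => MvPolynomial.eval z p * g z) ^ 2) :
    IsStrongPickSet (zeroSet p) f := by
  intro h hh hhf z hz
  by_contra hne
  obtain ⟨g, hg, hgF⟩ := exists_quotient hp hV (F := fun z => f z - h z)
    (hf.schur.analytic.sub hh.analytic) fun z hz => by rw [hhf z hz, sub_self]
  have hgz : g z ≠ 0 := by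
    intro hgz
    have := hgF z hz
    rw [hgz, mul_zero, sub_eq_zero] at this
    exact hne this.symm
  have hlt := hineq g hg ⟨2, fun z hz => by
    rw [← hgF z hz]
    exact (norm_sub_le _ _).trans
      (by linarith [hf.schur.norm_le_one z hz, hh.norm_le_one z hz])⟩ ⟨z, hz, hgz⟩
  have hcoeff : ∀ n, taylorCoeff (fun z => MvPolynomial.eval z p * g z) n =
      taylorCoeff f n - taylorCoeff h n := fun n => by
    rw [← taylorCoeff_sub hf.schur.analytic hh.analytic]
    exact taylorCoeff_congr (fun z hz => (hgF z hz).symm) n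
  have hsf := summable_norm_sq_taylorCoeff hf.schur.analytic hf.schur.norm_le_one
  have hsh := summable_norm_sq_taylorCoeff hh.analytic hh.norm_le_one
  set A := taylorCoeff f
  set B := taylorCoeff h
  have hsd : Summable fun n => ‖A n - B n‖ ^ 2 := by
    refine Summable.of_nonneg_of_le (fun _ => by positivity) (fun n => ?_)
      ((hsf.add hsh).mul_left 2)
    have h1 := pow_le_pow_left₀ (norm_nonneg _) (norm_sub_le (A n) (B n)) 2
    nlinarith [sq_nonneg (‖A n‖ - ‖B n‖)]
  have hsi : Summable fun n => A n * (starRingEnd ℂ) (A n - B n) := by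
    refine Summable.of_norm_bounded (hsf.add hsd) fun n => ?_
    rw [norm_mul, RCLike.norm_conj]
    nlinarith [sq_nonneg (‖A n‖ - ‖A n - B n‖), sq_nonneg (‖A n‖), sq_nonneg ‖A n - B n‖]
  rw [hardyNorm, Real.sq_sqrt (tsum_nonneg fun _ => by positivity), hardyInner] at hlt
  simp only [hcoeff] at hlt
  rw [Complex.re_tsum hsi] at hlt
  have hre : Summable fun n => (A n * (starRingEnd ℂ) (A n - B n)).re :=
    (Complex.hasSum_re hsi.hasSum).summable
  rw [← tsum_mul_left] at hlt
  have hle : ∑' n, ‖B n‖ ^ 2 ≤ ∑' n, ‖A n‖ ^ 2 :=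
    (hsh.tsum_le_of_sum_le fun s => (sum_norm_sq_taylorCoeff_le hh.analytic hh.norm_le_one s).trans
      (by norm_num)).trans (one_le_tsum_norm_sq_taylorCoeff hf)
  -- `2 Re ⟨f, f - h⟩ = ‖f - h‖² + ‖f‖² - ‖h‖²`, coefficient by coefficient
  have hident : ∀ n, 2 * (A n * (starRingEnd ℂ) (A n - B n)).re =
      ‖A n - B n‖ ^ 2 + (‖A n‖ ^ 2 - ‖B n‖ ^ 2) := by
    intro n
    simp only [← Complex.normSq_eq_norm_sq, Complex.normSq_apply, Complex.mul_re, Complex.sub_re,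
      Complex.sub_im, Complex.conj_re, Complex.conj_im, map_sub]
    ring
  simp only [hident] at hlt
  rw [hsd.tsum_add (hsf.sub hsh), hsf.tsum_sub hsh] at hlt
  linarith
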